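/- **Theorem 5.** There is an $O(1)$-competitive deterministic online algorithm for the hard $3$-taxi problem on the real line. In detail: three taxis are located on $\mathbb R$, in an initial configuration $C\in\mathbb R^3$, and a finite sequence $\sigma$ of requests $(s_1,t_1),\dots,(s_n,t_n)\in\mathbb R^2$ has to be served in order. To serve $(s_i,t_i)$, the taxis may move arbitrarily so that one of them is at $s_i$, and this taxi then carries the passenger to $t_i$. In the hard version, the cost of a schedule is the total distance that the taxis travel without a passenger, i.e. the ride from $s_i$ to $t_i$ is free. Let $\mathrm{OPT}(C,\sigma)$ be the optimal (infimum) cost of serving $\sigma$ from $C$ with full knowledge of $\sigma$. A deterministic online algorithm $A$ chooses its movement for the $i$-th request as a function of $C$ and the first $i$ requests only; let $\mathrm{cost}_A(C,\sigma)$ be its cost. Then there exist a deterministic online algorithm $A$ and constants $\rho$ and $c$ such that $$\mathrm{cost}_A(C,\sigma)\le \rho\cdot \mathrm{OPT}(C,\sigma)+c$$ for every initial configuration $C$ and every request sequence $\sigma$. -/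

import Mathlib

namespace KTaxi

/-- A configuration: the positions of `k` (labelled) taxis in the space `M`. -/
abbrev Config (k : ℕ) (M : Type*) := Fin k → M

/-- A request: a passenger has to be carried from `start` to `dest`. -/
structure Request (M : Type*) where
  start : M
  dest : M

/-- The reaction to one request. All taxis drive empty to the positions `pos` (any of them may
move), and then taxi number `taxi` carries the passenger. Empty driving after the drop-off is part
of the empty driving for the next request. -/
structure Move (k : ℕ) (M : Type*) where
  pos : Config k M
  taxi : Fin k

/-- The move `m` serves the request `r`: the serving taxi has driven to the start of `r`. -/
def Move.Serves {k : ℕ} {M : Type*} (m : Move k M) (r : Request M) : Prop :=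
  m.pos m.taxi = r.start

/-- The configuration after the move `m` for the request `r`: the serving taxi is at the
destination. -/
def Move.result {k : ℕ} {M : Type*} (m : Move k M) (r : Request M) : Config k M :=
  Function.update m.pos m.taxi r.dest

/-- The cost, in the hard version, of the move `m` from configuration `x`: the total distance of
the empty driving. The ride of the serving taxi from start to destination is not counted. -/
def Move.cost {k : ℕ} {M : Type*} [MetricSpace M] (x : Config k M) (m : Move k M) : ℝ :=
  ∑ i, dist (x i) (m.pos i)

/-- A schedule for the request sequence `σ`: one move for each request, in order, serving it. -/
def IsSchedule {k : ℕ} {M : Type*} (σ : List (Request M)) (ms : List (Move k M)) : Prop :=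
  List.Forall₂ (fun r m => Move.Serves m r) σ ms

/-- Total cost (hard version) of the moves `ms` for the requests `σ`, starting in
configuration `x`. -/
def scheduleCost {k : ℕ} {M : Type*} [MetricSpace M] :
    Config k M → List (Request M) → List (Move k M) → ℝ
  | x, r :: σ, m :: ms => Move.cost x m + scheduleCost (Move.result m r) σ ms
  | _, _, _ => 0

/-- The optimal offline cost for the requests `σ` from the initial configuration `C`
(for `0 < k` this is an infimum of a nonempty set of nonnegative reals). -/
noncomputable def opt {k : ℕ} {M : Type*} [MetricSpace M] (C : Config k M)
    (σ : List (Request M)) : ℝ :=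
  sInf {a : ℝ | ∃ ms : List (Move k M), IsSchedule σ ms ∧ a = scheduleCost C σ ms}

/-- A deterministic online algorithm for the `k`-taxi problem on `M`. Its move for the current
request `r` is determined by the initial configuration, the list of the earlier requests and `r`;
it has to serve `r`. -/
structure OnlineAlgorithm (k : ℕ) (M : Type*) where
  move : Config k M → List (Request M) → Request M → Move k M
  serves : ∀ C past r, Move.Serves (move C past r) r

/-- The moves of the algorithm for the requests `σ` that arrive after the requests `past`. -/
def OnlineAlgorithm.runFrom {k : ℕ} {M : Type*} (A : OnlineAlgorithm k M) (C : Config k M) :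
    List (Request M) → List (Request M) → List (Move k M)
  | _, [] => []
  | past, r :: σ => A.move C past r :: A.runFrom C (past ++ [r]) σ

/-- The cost (hard version) of the algorithm on the request sequence `σ` from the initial
configuration `C`. -/
def OnlineAlgorithm.cost {k : ℕ} {M : Type*} [MetricSpace M] (A : OnlineAlgorithm k M)
    (C : Config k M) (σ : List (Request M)) : ℝ :=
  scheduleCost C σ (A.runFrom C [] σ)

/-- The algorithm is `ρ`-competitive for the hard `k`-taxi problem on `M`. -/
def OnlineAlgorithm.IsCompetitive {k : ℕ} {M : Type*} [MetricSpace M] (A : OnlineAlgorithm k M)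
    (ρ : ℝ) : Prop :=
  ∃ c : ℝ, ∀ (C : Config k M) (σ : List (Request M)), A.cost C σ ≤ ρ * opt C σ + c

end KTaxi

namespace KTaxi

open Finset

/-! The proof analyses a randomized algorithm by a potential and then derandomizes it. The taxis
carry roles: role `0` is the last server, and roles `1` and `2` are the other two, role `1` being
the more reliable. The potential `pot` is the minimum over matchings with the offline taxis of 16
times the distance for role `0` plus `pairPot` for the rest. Besides the matching cost, `pairPot`
charges role `1` for standing beyond both of its offline partners. After a request both sides have a
taxi at the destination. So the free ride, however long, leaves only the `pairPot` of the other
taxis. `exists_goodMix` supplies serving probabilities for which a seventh of the expected cost plus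
the expected new potential is at most the old potential, whichever offline taxi stands at the start.
Since `pot` is 16-Lipschitz in the offline configuration, the randomized algorithm is
112-competitive. The deterministic algorithm simulates the distribution of the randomized one and
treats it as a random offline schedule. Sampling its own next step would satisfy the potential
inequality on average, so some fixed option satisfies it (`IsMean.exists_option`). It thus pays at
most 112 times the expected randomized cost, which gives the ratio 112² = 12544. -/

/-! ### The asymmetric potential of two pairs of points on the line -/

/-- The cost of a minimum matching between the pairs `{a, b}` and `{u, v}` of reals. -/
noncomputable def pairDist (a b u v : ℝ) : ℝ := min (|a - u| + |b - v|) (|a - v| + |b - u|)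

/-- The length of the part of the segment from `a` to `b` that has both `u` and `v` on the side
of `b`. -/
noncomputable def overshoot (a b u v : ℝ) : ℝ :=
  max 0 (max (min u (min v b) - a) (a - max u (max v b)))

/-- The discrepancy between the two taxis `a`, `b` and the two taxis `u`, `v`, where a wrong
position of `a` weighs more than a wrong position of `b`. -/
noncomputable def pairPot (a b u v : ℝ) : ℝ := pairDist a b u v + 2 * overshoot a b u v

lemma overshoot_nonneg (a b u v : ℝ) : 0 ≤ overshoot a b u v := le_max_left _ _

lemma pairDist_nonneg (a b u v : ℝ) : 0 ≤ pairDist a b u v := by unfold pairDist; positivity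

lemma pairPot_nonneg (a b u v : ℝ) : 0 ≤ pairPot a b u v := by
  unfold pairPot
  have := overshoot_nonneg a b u v
  have := pairDist_nonneg a b u v
  linarith

lemma overshoot_comm_right (a b u v : ℝ) : overshoot a b u v = overshoot a b v u := by
  unfold overshoot
  rw [min_left_comm, max_left_comm u]

lemma pairDist_comm_right (a b u v : ℝ) : pairDist a b u v = pairDist a b v u := by
  unfold pairDist
  rw [min_comm]

lemma pairDist_comm_left (a b u v : ℝ) : pairDist a b u v = pairDist b a u v := by
  unfold pairDist
  rw [min_comm, add_comm, add_comm (|a - u|)]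

lemma pairPot_comm_right (a b u v : ℝ) : pairPot a b u v = pairPot a b v u := by
  unfold pairPot
  rw [overshoot_comm_right, pairDist_comm_right]

lemma overshoot_of_le {a b : ℝ} (h : a ≤ b) (u v : ℝ) :
    overshoot a b u v = max 0 (min u (min v b) - a) := by
  unfold overshoot
  rw [← max_assoc, max_eq_left]
  exact le_max_of_le_left (by
    have := (le_max_right v b).trans (le_max_right u (max v b))
    linarith)

lemma overshoot_of_ge {a b : ℝ} (h : b ≤ a) (u v : ℝ) :
    overshoot a b u v = max 0 (a - max u (max v b)) := by
  unfold overshoot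
  rw [max_left_comm, max_eq_right]
  exact le_max_of_le_left (by
    have := (min_le_right u (min v b)).trans (min_le_right v b)
    linarith)

lemma overshoot_self_right (a b v : ℝ) : overshoot a b a v = 0 := by
  unfold overshoot
  have h1 := min_le_left a (min v b)
  have h2 := le_max_left a (max v b)
  exact max_eq_left (max_le (by linarith) (by linarith))

lemma overshoot_neg (a b u v : ℝ) : overshoot (-a) (-b) (-u) (-v) = overshoot a b u v := by
  unfold overshoot
  rw [min_neg_neg, min_neg_neg, max_neg_neg, max_neg_neg, max_comm (_ - _)]
  congr 2 <;> ring

lemma overshoot_sub (a b u v s : ℝ) :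
    overshoot (a - s) (b - s) (u - s) (v - s) = overshoot a b u v := by
  unfold overshoot
  rw [min_sub_sub_right, min_sub_sub_right, max_sub_sub_right, max_sub_sub_right]
  congr 2 <;> ring

lemma pairDist_neg (a b u v : ℝ) : pairDist (-a) (-b) (-u) (-v) = pairDist a b u v := by
  unfold pairDist
  simp only [neg_sub_neg, abs_sub_comm]

lemma pairDist_sub (a b u v s : ℝ) :
    pairDist (a - s) (b - s) (u - s) (v - s) = pairDist a b u v := by
  unfold pairDist
  simp only [sub_sub_sub_cancel_right]

lemma pairPot_neg (a b u v : ℝ) : pairPot (-a) (-b) (-u) (-v) = pairPot a b u v := by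
  unfold pairPot
  rw [overshoot_neg, pairDist_neg]

lemma pairPot_sub (a b u v s : ℝ) :
    pairPot (a - s) (b - s) (u - s) (v - s) = pairPot a b u v := by
  unfold pairPot
  rw [overshoot_sub, pairDist_sub]

lemma pairPot_self (a b : ℝ) : pairPot a b a b = 0 := by
  unfold pairPot pairDist
  rw [overshoot_self_right]
  simp
  positivity

lemma pairDist_le_left (a c b u v : ℝ) : pairDist a b u v ≤ pairDist c b u v + |c - a| := by
  unfold pairDist
  grind

lemma overshoot_le_left (a c b u v : ℝ) : overshoot a b u v ≤ overshoot c b u v + |c - a| := by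
  unfold overshoot
  grind

lemma pairDist_le_mid (a b c u v : ℝ) : pairDist a b u v ≤ pairDist a c u v + |c - b| := by
  unfold pairDist
  grind

lemma overshoot_le_mid (a b c u v : ℝ) : overshoot a b u v ≤ overshoot a c u v + |c - b| := by
  unfold overshoot
  grind

lemma pairDist_le_right (a b u v w : ℝ) : pairDist a b u v ≤ pairDist a b w v + |w - u| := by
  unfold pairDist
  grind

lemma overshoot_le_right (a b u v w : ℝ) : overshoot a b u v ≤ overshoot a b w v + |w - u| := by
  unfold overshoot
  grind

lemma overshoot_le_dist (a b u v : ℝ) : overshoot a b u v ≤ |a - b| := by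
  unfold overshoot
  grind

/-- The Lipschitz constant is 3 = 1 + 2: one for the matching and two for the doubled overshoot. -/
lemma pairPot_le_left (a c b u v : ℝ) : pairPot a b u v ≤ pairPot c b u v + 3 * |c - a| := by
  unfold pairPot
  linarith [pairDist_le_left a c b u v, overshoot_le_left a c b u v]

lemma pairPot_le_mid (a b c u v : ℝ) : pairPot a b u v ≤ pairPot a c u v + 3 * |c - b| := by
  unfold pairPot
  linarith [pairDist_le_mid a b c u v, overshoot_le_mid a b c u v]

lemma pairPot_le_right (a b u v w : ℝ) : pairPot a b u v ≤ pairPot a b w v + 3 * |w - u| := by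
  unfold pairPot
  linarith [pairDist_le_right a b u v w, overshoot_le_right a b u v w]

lemma pairPot_le_swap (a b u v : ℝ) : pairPot b a u v ≤ pairPot a b u v + 2 * |b - a| := by
  unfold pairPot
  linarith [pairDist_comm_left a b u v, overshoot_nonneg a b u v, overshoot_le_dist b a u v]

lemma pairPot_self_left_le (a b v : ℝ) : pairPot a b a v ≤ |b - v| := by
  unfold pairPot pairDist
  rw [overshoot_self_right]
  have := min_le_left (|a - a| + |b - v|) (|a - v| + |b - a|)
  simpa only [sub_self, abs_zero, zero_add, mul_zero, add_zero] using this

lemma pairPot_self_mid_le (a b v : ℝ) : pairPot a b b v ≤ |a - v| + 2 * overshoot a b b v := by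
  unfold pairPot pairDist
  have := min_le_right (|a - b| + |b - v|) (|a - v| + |b - b|)
  simp only [sub_self, abs_zero, add_zero] at this ⊢
  linarith

/-- On a line some optimal matching does not cross. This and the next two bounds thereby decide
which taxi is paired with the request point `0`. -/
lemma le_pairDist_of_nonneg {a b : ℝ} (ha : 0 ≤ a) (hab : a ≤ b) (v : ℝ) :
    |b - v| + a ≤ pairDist a b 0 v := by
  unfold pairDist
  grind

lemma le_pairDist_of_nonpos {a b v : ℝ} (ha : a ≤ 0) (hb : 0 ≤ b) (hv : v ≤ 0) :
    |a - v| + b ≤ pairDist a b 0 v := by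
  unfold pairDist
  grind

lemma le_pairDist_of_nonneg_right {a b v : ℝ} (ha : a ≤ 0) (hv : 0 ≤ v) :
    |b - v| - a ≤ pairDist a b 0 v := by
  unfold pairDist
  grind

/-! ### Conditions for good serving probabilities -/

/-- The potential after the taxi at `x₂` has been used, where with probability `θ` the taxi at
`x₀` becomes the more reliable one of the remaining taxis. -/
noncomputable def mixPot (θ x₀ x₁ u v : ℝ) : ℝ :=
  (1 - θ) * pairPot x₁ x₀ u v + θ * pairPot x₀ x₁ u v

/-- `p₀`, `p₁`, `p₂` are good probabilities for serving a request at `s` with the taxi at `x₀`,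
`x₁`, `x₂`, and `θ` is a good probability for exchanging roles in the last case. -/
structure IsGoodMix (x₀ x₁ x₂ s p₀ p₁ p₂ θ : ℝ) : Prop where
  p₀_nonneg : 0 ≤ p₀
  p₁_nonneg : 0 ≤ p₁
  p₂_nonneg : 0 ≤ p₂
  sum_eq_one : p₀ + p₁ + p₂ = 1
  θ_nonneg : 0 ≤ θ
  θ_le_one : θ ≤ 1
  pot_le : ∀ u v, p₀ * (pairPot x₁ x₂ u v + |x₀ - s| / 7) +
    p₁ * (pairPot x₀ x₂ u v + |x₁ - s| / 7) + p₂ * (mixPot θ x₀ x₁ u v + |x₂ - s| / 7) ≤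
    pairPot x₁ x₂ u v + 16 * |x₀ - s|
  pot_le' : ∀ v, p₀ * (pairPot x₁ x₂ x₀ v + |x₀ - s| / 7) +
    p₁ * (pairPot x₀ x₂ x₀ v + |x₁ - s| / 7) + p₂ * (mixPot θ x₀ x₁ x₀ v + |x₂ - s| / 7) ≤
    pairPot x₁ x₂ s v

lemma IsGoodMix.neg {x₀ x₁ x₂ p₀ p₁ p₂ θ : ℝ} (h : IsGoodMix (-x₀) (-x₁) (-x₂) 0 p₀ p₁ p₂ θ) :
    IsGoodMix x₀ x₁ x₂ 0 p₀ p₁ p₂ θ := by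
  refine ⟨h.1, h.2, h.3, h.4, h.5, h.6, fun u v => ?_, fun v => ?_⟩
  · simpa only [mixPot, pairPot_neg, sub_zero, abs_neg] using h.pot_le (-u) (-v)
  · have := h.pot_le' (-v)
    have h0 : pairPot (-x₁) (-x₂) 0 (-v) = pairPot x₁ x₂ 0 v := by
      simpa using pairPot_neg x₁ x₂ 0 v
    simpa only [mixPot, pairPot_neg, h0, sub_zero, abs_neg] using this

lemma IsGoodMix.of_sub {x₀ x₁ x₂ s p₀ p₁ p₂ θ : ℝ}
    (h : IsGoodMix (x₀ - s) (x₁ - s) (x₂ - s) 0 p₀ p₁ p₂ θ) :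
    IsGoodMix x₀ x₁ x₂ s p₀ p₁ p₂ θ := by
  refine ⟨h.1, h.2, h.3, h.4, h.5, h.6, fun u v => ?_, fun v => ?_⟩
  · simpa only [mixPot, pairPot_sub, sub_zero] using h.pot_le (u - s) (v - s)
  · have := h.pot_le' (v - s)
    rw [← sub_self s] at this
    simpa only [mixPot, pairPot_sub, sub_sub_sub_cancel_right] using this

/-- In `hI` the 3 is the Lipschitz constant of `pairPot` and the 2 is the price of exchanging roles.
It also gives `p₁ * |x₁ - x₀| + p₂ * |x₂ - x₀| ≤ 5 * |x₀|`, so a seventh of the expected cost is at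
most 6/7 of `|x₀|`; this is why 15 out of 16 suffices. In `hII` each `eᵢ` bounds the change of
potential when role `i` serves; in the last two cases the taxi at `x₀` stays behind and matches the
offline taxi there exactly. -/
lemma IsGoodMix.of_bounds {x₀ x₁ x₂ p₀ p₁ p₂ θ : ℝ} (h₀ : 0 ≤ p₀) (h₁ : 0 ≤ p₁) (h₂ : 0 ≤ p₂)
    (hsum : p₀ + p₁ + p₂ = 1) (hθ₀ : 0 ≤ θ) (hθ₁ : θ ≤ 1)
    (hI : 3 * (p₁ * |x₁ - x₀|) + p₂ * (3 * |x₂ - x₀| + 2 * (θ * |x₀ - x₁|)) ≤ 15 * |x₀|)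
    (hII : ∀ v, ∃ e₀ e₁ e₂, pairPot x₁ x₂ x₀ v ≤ pairPot x₁ x₂ 0 v + e₀ ∧
      |x₂ - v| ≤ pairPot x₁ x₂ 0 v + e₁ ∧
      |x₁ - v| + 2 * ((1 - θ) * overshoot x₁ x₀ x₀ v) ≤ pairPot x₁ x₂ 0 v + e₂ ∧
      p₀ * (e₀ + |x₀| / 7) + p₁ * (e₁ + |x₁| / 7) + p₂ * (e₂ + |x₂| / 7) ≤ 0) :
    IsGoodMix x₀ x₁ x₂ 0 p₀ p₁ p₂ θ := by
  refine ⟨h₀, h₁, h₂, hsum, hθ₀, hθ₁, fun u v => ?_, fun v => ?_⟩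
  · have a1 := pairPot_le_left x₀ x₁ x₂ u v
    have a2 : mixPot θ x₀ x₁ u v ≤
        pairPot x₁ x₂ u v + (3 * |x₂ - x₀| + 2 * (θ * |x₀ - x₁|)) := by
      have b1 := pairPot_le_mid x₁ x₀ x₂ u v
      have b2 := mul_le_mul_of_nonneg_left (pairPot_le_swap x₁ x₀ u v) hθ₀
      unfold mixPot
      linarith
    have a3 := mul_le_mul_of_nonneg_left a1 h₁
    have a4 := mul_le_mul_of_nonneg_left a2 h₂
    have c1 : |x₁| ≤ |x₁ - x₀| + |x₀| := by simpa using abs_add_le (x₁ - x₀) x₀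
    have c2 : |x₂| ≤ |x₂ - x₀| + |x₀| := by simpa using abs_add_le (x₂ - x₀) x₀
    have c3 := mul_le_mul_of_nonneg_left c1 h₁
    have c4 := mul_le_mul_of_nonneg_left c2 h₂
    have c5 : |x₀| = p₀ * |x₀| + p₁ * |x₀| + p₂ * |x₀| := by
      rw [← add_mul, ← add_mul, hsum, one_mul]
    have c6 : 0 ≤ p₂ * (θ * |x₀ - x₁|) := by positivity
    have c7 := mul_nonneg h₁ (abs_nonneg (x₁ - x₀))
    have c8 := mul_nonneg h₂ (abs_nonneg (x₂ - x₀))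
    have : pairPot x₁ x₂ u v = p₀ * pairPot x₁ x₂ u v + p₁ * pairPot x₁ x₂ u v +
        p₂ * pairPot x₁ x₂ u v := by rw [← add_mul, ← add_mul, hsum, one_mul]
    simp only [sub_zero]
    linarith
  · obtain ⟨e₀, e₁, e₂, b0, b1, b2, hs⟩ := hII v
    have c1 := (pairPot_self_left_le x₀ x₂ v).trans b1
    have c2 : mixPot θ x₀ x₁ x₀ v ≤ pairPot x₁ x₂ 0 v + e₂ := by
      refine le_trans ?_ b2
      have d1 := mul_le_mul_of_nonneg_left (pairPot_self_mid_le x₁ x₀ v) (sub_nonneg.2 hθ₁)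
      have d2 := mul_le_mul_of_nonneg_left (pairPot_self_left_le x₀ x₁ v) hθ₀
      unfold mixPot
      linarith
    have a0 := mul_le_mul_of_nonneg_left b0 h₀
    have a1 := mul_le_mul_of_nonneg_left c1 h₁
    have a2 := mul_le_mul_of_nonneg_left c2 h₂
    have : pairPot x₁ x₂ 0 v = p₀ * pairPot x₁ x₂ 0 v + p₁ * pairPot x₁ x₂ 0 v +
        p₂ * pairPot x₁ x₂ 0 v := by rw [← add_mul, ← add_mul, hsum, one_mul]
    simp only [sub_zero]
    linarith

lemma exists_weights_two {a b : ℝ} (ha : 0 ≤ a) (hb : 0 ≤ b) (hab : 0 < a + b) :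
    ∃ p q : ℝ, 0 ≤ p ∧ 0 ≤ q ∧ p + q = 1 ∧ p * a = q * b :=
  ⟨b / (a + b), a / (a + b), by positivity, by positivity, by field_simp; ring, by ring⟩

lemma exists_weights_three {a b c : ℝ} (ha : 0 < a) (hb : 0 < b) (hc : 0 < c) :
    ∃ p q r : ℝ, 0 ≤ p ∧ 0 ≤ q ∧ 0 ≤ r ∧ p + q + r = 1 ∧ p * a = q * b ∧ q * b = r * c :=
  ⟨b * c / (b * c + a * c + a * b), a * c / (b * c + a * c + a * b),
    a * b / (b * c + a * c + a * b), by positivity, by positivity, by positivity,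
    by field_simp, by ring, by ring⟩

lemma mul_max_zero_min_le {t w A B : ℝ} (ht₀ : 0 ≤ t) (ht₁ : t ≤ 1) (hAB : t * A = B) :
    t * max 0 (min w A) ≤ max 0 (min w B) := by
  rcases le_total (min w A) 0 with h | h
  · rw [max_eq_left h, mul_zero]
    exact le_max_left _ _
  · rw [max_eq_right h]
    refine le_max_of_le_right (le_min ?_ ?_)
    · have := min_le_left w A
      nlinarith
    · rw [← hAB]
      exact mul_le_mul_of_nonneg_left (min_le_right _ _) ht₀

/-- Both overshoots are measured from `a` and cut off at `v`. The factor `t` shrinks the full length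
`b - a` to `-a`, and `t ≤ 1` can only shorten the part up to `v`. -/
lemma mul_overshoot_le_of_le {a b c t v : ℝ} (ht₀ : 0 ≤ t) (ht₁ : t ≤ 1) (ha : a ≤ 0)
    (hb : 0 ≤ b) (hc : 0 ≤ c) (ht : t * (b - a) = -a) :
    t * overshoot a b b v ≤ overshoot a c 0 v := by
  rw [overshoot_of_le (ha.trans hb), overshoot_of_le (ha.trans hc)]
  have h1 : min b (min v b) - a = min (v - a) (b - a) := by
    rw [min_left_comm, min_self, min_sub_sub_right]
  have h2 : max 0 (min (v - a) (-a)) ≤ max 0 (min 0 (min v c) - a) := by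
    refine max_le_max le_rfl ?_
    have : min 0 (min v c) = min v 0 := by rw [min_left_comm, min_eq_left hc]
    rw [this, ← min_sub_sub_right, zero_sub]
  rw [h1]
  exact (mul_max_zero_min_le ht₀ ht₁ ht).trans h2

lemma mul_overshoot_le_of_ge {a b c t v : ℝ} (ht₀ : 0 ≤ t) (ht₁ : t ≤ 1) (hb : b ≤ 0)
    (hc : 0 ≤ c) (hca : c ≤ a) (ht : t * (a - b) = a - c) :
    t * overshoot a b b v ≤ overshoot a c 0 v := by
  rw [overshoot_of_ge (hb.trans (hc.trans hca)), overshoot_of_ge hca]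
  have h1 : a - max b (max v b) = min (a - v) (a - b) := by
    rw [max_left_comm, max_self, min_sub_sub_left]
  have h2 : max 0 (min (a - v) (a - c)) ≤ max 0 (a - max 0 (max v c)) := by
    refine max_le_max le_rfl ?_
    rw [max_left_comm, max_eq_right hc, min_sub_sub_left]
  rw [h1]
  exact (mul_max_zero_min_le ht₀ ht₁ ht).trans h2

/-! ### Good probabilities, by the positions of the taxis around the request -/

/-- The lone taxi on the left competes with the nearer of the two on the right. The probabilities
equalize weighted distances, so a far taxi is rarely used. -/
lemma exists_goodMix_of_neg_zero {x₀ x₁ x₂ : ℝ} (h₀ : x₀ < 0) (h₁ : 0 ≤ x₁) (h₂ : 0 ≤ x₂) :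
    ∃ p₀ p₁ p₂ θ, IsGoodMix x₀ x₁ x₂ 0 p₀ p₁ p₂ θ := by
  rcases le_total x₁ x₂ with h | h
  · obtain ⟨p, q, hp, hq, hpq, he⟩ :=
      exists_weights_two (a := -2 * x₀) (b := x₁) (by linarith) h₁ (by linarith)
    refine ⟨p, q, 0, 0, IsGoodMix.of_bounds hp hq le_rfl (by linarith) le_rfl zero_le_one ?_
      fun v => ⟨-x₀, -x₁, _, ?_, ?_, sub_le_iff_le_add'.1 le_rfl, ?_⟩⟩
    · rw [abs_of_nonneg (by linarith : 0 ≤ x₁ - x₀), abs_of_neg h₀]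
      nlinarith
    · have h3 := pairDist_le_right x₁ x₂ x₀ v 0
      have h4 : overshoot x₁ x₂ x₀ v = 0 := by
        rw [overshoot_of_le h]
        have := min_le_left x₀ (min v x₂)
        exact max_eq_left (by linarith)
      rw [zero_sub, abs_of_nonneg (by linarith : 0 ≤ -x₀)] at h3
      have := overshoot_nonneg x₁ x₂ 0 v
      unfold pairPot
      linarith
    · have := overshoot_nonneg x₁ x₂ 0 v
      have := le_pairDist_of_nonneg h₁ h v
      unfold pairPot
      linarith
    · rw [abs_of_neg h₀, abs_of_nonneg h₁]
      nlinarith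
  · obtain ⟨p, q, hp, hq, hpq, he⟩ :=
      exists_weights_two (a := -2 * x₀) (b := x₂) (by linarith) h₂ (by linarith)
    -- With this `θ`, `(1 - θ) * (x₁ - x₀) = x₁ - x₂`: the expected new overshoot is covered by the
    -- old one.
    have hpos : 0 < x₁ - x₀ := by linarith
    have hθ : (x₂ - x₀) / (x₁ - x₀) * (x₁ - x₀) = x₂ - x₀ := div_mul_cancel₀ _ hpos.ne'
    have hθ₀ : 0 ≤ (x₂ - x₀) / (x₁ - x₀) := div_nonneg (by linarith) hpos.le
    have hθ₁ : (x₂ - x₀) / (x₁ - x₀) ≤ 1 := (div_le_one hpos).2 (by linarith)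
    set θ := (x₂ - x₀) / (x₁ - x₀)
    refine ⟨p, 0, q, θ, IsGoodMix.of_bounds hp le_rfl hq (by linarith) hθ₀ hθ₁ ?_
      fun v => ⟨-x₀, _, -x₂, ?_, sub_le_iff_le_add'.1 le_rfl, ?_, ?_⟩⟩
    · rw [abs_of_nonneg (by linarith : 0 ≤ x₂ - x₀), abs_of_neg h₀, abs_sub_comm x₀,
        abs_of_pos hpos, hθ]
      nlinarith
    · have h3 := pairDist_le_right x₁ x₂ x₀ v 0
      have h4 : overshoot x₁ x₂ x₀ v ≤ overshoot x₁ x₂ 0 v := by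
        rw [overshoot_of_ge h, overshoot_of_ge h]
        refine max_le_max le_rfl (sub_le_sub_left (max_le ?_ (le_max_right _ _)) _)
        exact h₂.trans ((le_max_right _ _).trans (le_max_right _ _))
      rw [zero_sub, abs_of_nonneg (by linarith : 0 ≤ -x₀)] at h3
      unfold pairPot
      linarith
    · have h3 := le_pairDist_of_nonneg h₂ h v
      rw [pairDist_comm_left] at h3
      have h4 := mul_overshoot_le_of_ge (v := v) (sub_nonneg.2 hθ₁) (by linarith) h₀.le h₂ h
        (by linarith)
      unfold pairPot
      linarith
    · rw [abs_of_neg h₀, abs_of_nonneg h₂]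
      nlinarith

lemma exists_goodMix_of_neg_one {x₀ x₁ x₂ : ℝ} (h₀ : 0 ≤ x₀) (h₁ : x₁ < 0) (h₂ : 0 ≤ x₂)
    (hne : x₀ ≠ 0) : ∃ p₀ p₁ p₂ θ, IsGoodMix x₀ x₁ x₂ 0 p₀ p₁ p₂ θ := by
  have h₀' : 0 < x₀ := lt_of_le_of_ne h₀ hne.symm
  -- Here `(1 - θ) * (x₀ - x₁) = -x₁`, the part of the segment from `x₁` to `x₀` before the request.
  have hpos : 0 < x₀ - x₁ := by linarith
  have hθ : x₀ / (x₀ - x₁) * (x₀ - x₁) = x₀ := div_mul_cancel₀ _ hpos.ne'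
  have hθ₀ : 0 ≤ x₀ / (x₀ - x₁) := div_nonneg h₀ hpos.le
  have hθ₁ : x₀ / (x₀ - x₁) ≤ 1 := (div_le_one hpos).2 (by linarith)
  set θ := x₀ / (x₀ - x₁)
  have hO v : (1 - θ) * overshoot x₁ x₀ x₀ v ≤ overshoot x₁ x₂ 0 v :=
    mul_overshoot_le_of_le (sub_nonneg.2 hθ₁) (by linarith) h₁.le h₀ h₂ (by linarith)
  have hOpos {v} (hv : 0 ≤ v) : overshoot x₁ x₂ 0 v = -x₁ := by
    rw [overshoot_of_le (by linarith), min_eq_left (le_min hv h₂), zero_sub,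
      max_eq_right (by linarith)]
  have hA {v} (hv : v ≤ 0) : |x₂ - v| ≤ pairPot x₁ x₂ 0 v + -x₁ := by
    have h3 := le_pairDist_of_nonpos h₁.le h₂ hv
    have h4 := overshoot_nonneg x₁ x₂ 0 v
    have h5 := le_abs_self (x₁ - v)
    rw [abs_of_nonneg (by linarith)]
    unfold pairPot
    linarith
  have hB {v} (hv : 0 ≤ v) : |x₂ - v| ≤ pairPot x₁ x₂ 0 v + 3 * x₁ := by
    have h3 := le_pairDist_of_nonneg_right (b := x₂) h₁.le hv
    unfold pairPot
    rw [hOpos hv]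
    linarith
  have hC {v} (hv : v ≤ 0) : |x₁ - v| + 2 * ((1 - θ) * overshoot x₁ x₀ x₀ v) ≤
      pairPot x₁ x₂ 0 v + -x₂ := by
    have h3 := le_pairDist_of_nonpos h₁.le h₂ hv
    have := hO v
    unfold pairPot
    linarith
  have hD {v} (hv : 0 ≤ v) : |x₁ - v| + 2 * ((1 - θ) * overshoot x₁ x₀ x₀ v) ≤
      pairPot x₁ x₂ 0 v + x₂ := by
    have h3 := le_pairDist_of_nonneg_right (b := x₂) h₁.le hv
    have := hO v
    have h5 := neg_abs_le (x₂ - v)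
    rw [abs_of_nonpos (by linarith)]
    unfold pairPot
    linarith
  rcases le_total x₀ x₂ with h | h
  -- The only case that mixes all three taxis. With the weights 3, 2, 3 the balances for `v ≤ 0` and
  -- for `v ≥ 0` both vanish exactly, so the fraction 1/7 of the cost has no slack here.
  · obtain ⟨p, q, r, hp, hq, hr, hsum, he, he'⟩ :=
      exists_weights_three (a := 3 * x₀) (b := -2 * x₁) (c := 3 * x₂) (by linarith) (by linarith)
        (by linarith)
    have hpx : 0 ≤ p * x₀ := mul_nonneg hp h₀
    have hrx : r * x₀ ≤ r * x₂ := mul_le_mul_of_nonneg_left h hr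
    have hrx₀ : 0 ≤ r * x₀ := mul_nonneg hr h₀
    have hqx₀ : q * x₀ ≤ x₀ := by nlinarith
    have hpx₀ : p * x₀ ≤ x₀ := by nlinarith
    refine ⟨p, q, r, θ, IsGoodMix.of_bounds hp hq hr hsum hθ₀ hθ₁ ?_ fun v => ?_⟩
    · rw [abs_of_nonpos (by linarith : x₁ - x₀ ≤ 0), abs_of_nonneg (by linarith : 0 ≤ x₂ - x₀),
        abs_of_pos hpos, hθ, abs_of_pos h₀']
      linarith
    · rcases le_total v 0 with hv | hv
      · refine ⟨-x₀, -x₁, -x₂, ?_, hA hv, hC hv, ?_⟩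
        · have h3 := le_pairDist_of_nonpos h₁.le h₂ hv
          have h4 : pairDist x₁ x₂ x₀ v ≤ |x₁ - v| + |x₂ - x₀| := min_le_right _ _
          have h5 : overshoot x₁ x₂ x₀ v = overshoot x₁ x₂ 0 v := by
            rw [overshoot_of_le (by linarith), overshoot_of_le (by linarith),
              min_eq_right ((min_le_left v x₂).trans (hv.trans h₀)),
              min_eq_right ((min_le_left v x₂).trans hv)]
          rw [abs_of_nonneg (by linarith : 0 ≤ x₂ - x₀)] at h4
          unfold pairPot
          linarith
        · rw [abs_of_pos h₀', abs_of_neg h₁, abs_of_nonneg h₂]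
          linarith
      · refine ⟨3 * x₀, 3 * x₁, x₂, ?_, hB hv, hD hv, ?_⟩
        · simpa [abs_of_pos h₀'] using pairPot_le_right x₁ x₂ x₀ v 0
        · rw [abs_of_pos h₀', abs_of_neg h₁, abs_of_nonneg h₂]
          linarith
  · obtain ⟨q, r, hq, hr, hsum, he⟩ :=
      exists_weights_two (a := -2 * x₁) (b := x₂) (by linarith) h₂ (by linarith)
    have hrx : r * x₂ ≤ r * x₀ := mul_le_mul_of_nonneg_left h hr
    have hrx₂ : 0 ≤ r * x₂ := mul_nonneg hr h₂
    have hqx₀ : q * x₀ ≤ x₀ := by nlinarith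
    have hrx₀ : r * x₀ ≤ x₀ := by nlinarith
    refine ⟨0, q, r, θ, IsGoodMix.of_bounds le_rfl hq hr (by linarith) hθ₀ hθ₁ ?_ fun v => ?_⟩
    · rw [abs_of_nonpos (by linarith : x₁ - x₀ ≤ 0), abs_of_nonpos (by linarith : x₂ - x₀ ≤ 0),
        abs_of_pos hpos, hθ, abs_of_pos h₀']
      linarith
    · rcases le_total v 0 with hv | hv
      -- An option of probability zero needs no estimate: its `e` is just the difference of the two
      -- sides.
      · refine ⟨_, -x₁, -x₂, sub_le_iff_le_add'.1 le_rfl, hA hv, hC hv, ?_⟩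
        rw [abs_of_neg h₁, abs_of_nonneg h₂]
        linarith
      · refine ⟨_, 3 * x₁, x₂, sub_le_iff_le_add'.1 le_rfl, hB hv, hD hv, ?_⟩
        rw [abs_of_neg h₁, abs_of_nonneg h₂]
        linarith

lemma exists_goodMix_of_neg_two {x₀ x₁ x₂ : ℝ} (h₀ : 0 ≤ x₀) (h₁ : 0 ≤ x₁) (h₂ : x₂ < 0) :
    ∃ p₀ p₁ p₂ θ, IsGoodMix x₀ x₁ x₂ 0 p₀ p₁ p₂ θ := by
  have hx : x₂ ≤ x₁ := by linarith
  have hOneg {v} (hv : v ≤ 0) : overshoot x₁ x₂ 0 v = x₁ := by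
    rw [overshoot_of_ge hx, max_eq_left (max_le hv h₂.le), sub_zero, max_eq_right h₁]
  have hDneg {v} (hv : v ≤ 0) : |x₂ - v| + x₁ ≤ pairDist x₁ x₂ 0 v := by
    rw [pairDist_comm_left]
    exact le_pairDist_of_nonpos h₂.le h₁ hv
  have hDpos {v} (hv : 0 ≤ v) : |x₁ - v| - x₂ ≤ pairDist x₁ x₂ 0 v := by
    rw [pairDist_comm_left]
    exact le_pairDist_of_nonneg_right h₂.le hv
  rcases le_total x₀ x₁ with h | h
  · obtain ⟨p, r, hp, hr, hsum, he⟩ :=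
      exists_weights_two (a := 2 * x₀) (b := -x₂) (by linarith) (by linarith) (by linarith)
    have hpx : 0 ≤ p * x₀ := mul_nonneg hp h₀
    have hrx : 0 ≤ r * x₀ := mul_nonneg hr h₀
    have hrx₀ : r * x₀ ≤ x₀ := by nlinarith
    have hpx₀ : p * x₀ ≤ x₀ := by nlinarith
    refine ⟨p, 0, r, 0, IsGoodMix.of_bounds hp le_rfl hr (by linarith) le_rfl zero_le_one ?_
      fun v => ?_⟩
    · rw [abs_of_nonpos (by linarith : x₂ - x₀ ≤ 0), abs_of_nonneg h₀]
      linarith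
    · have hO₁ : overshoot x₁ x₂ x₀ v ≤ overshoot x₁ x₂ 0 v := by
        rw [overshoot_of_ge hx, overshoot_of_ge hx]
        exact max_le_max le_rfl (sub_le_sub_left (max_le_max h₀ le_rfl) _)
      have hO₂ : overshoot x₁ x₀ x₀ v ≤ overshoot x₁ x₂ 0 v := by
        rw [overshoot_of_ge hx, overshoot_of_ge h]
        exact max_le_max le_rfl (sub_le_sub_left (max_le_max h₀
          (max_le_max le_rfl (by linarith))) _)
      rcases le_total v 0 with hv | hv
      -- Both offline taxis lie on the far side of `x₁`, so the doubled overshoot drops by `2 * x₀`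
      -- in either case; this pays for the use of `x₂`.
      · refine ⟨-3 * x₀, _, -x₂ - 2 * x₀, ?_, sub_le_iff_le_add'.1 le_rfl, ?_, ?_⟩
        · have h3 := hDneg hv
          have h4 : pairDist x₁ x₂ x₀ v ≤ |x₁ - x₀| + |x₂ - v| := min_le_left _ _
          have h5 : overshoot x₁ x₂ x₀ v = x₁ - x₀ := by
            rw [overshoot_of_ge hx, max_eq_left (max_le (hv.trans h₀) (h₂.le.trans h₀)),
              max_eq_right (by linarith)]
          have h6 := hOneg hv
          rw [abs_of_nonneg (by linarith : 0 ≤ x₁ - x₀)] at h4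
          unfold pairPot
          linarith
        · have h3 := hDneg hv
          have h5 : overshoot x₁ x₀ x₀ v = x₁ - x₀ := by
            rw [overshoot_of_ge h, max_eq_left (max_le (hv.trans h₀) le_rfl),
              max_eq_right (by linarith)]
          have h6 := hOneg hv
          have h7 := le_abs_self (x₂ - v)
          rw [abs_of_nonneg (by linarith : 0 ≤ x₁ - v)]
          unfold pairPot
          linarith
        · rw [abs_of_nonneg h₀, abs_of_neg h₂]
          linarith
      · refine ⟨x₀, _, x₂, ?_, sub_le_iff_le_add'.1 le_rfl, ?_, ?_⟩
        · have h3 := pairDist_le_right x₁ x₂ x₀ v 0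
          rw [zero_sub, abs_neg, abs_of_nonneg h₀] at h3
          unfold pairPot
          linarith
        · have h3 := hDpos hv
          unfold pairPot
          linarith
        · rw [abs_of_nonneg h₀, abs_of_neg h₂]
          linarith
  · obtain ⟨q, r, hq, hr, hsum, he⟩ :=
      exists_weights_two (a := 2 * x₁) (b := -x₂) (by linarith) (by linarith) (by linarith)
    have hqx₁ : 0 ≤ q * x₁ := mul_nonneg hq h₁
    have hrx₁ : 0 ≤ r * x₁ := mul_nonneg hr h₁
    have hqx : q * x₁ ≤ q * x₀ := mul_le_mul_of_nonneg_left h hq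
    have hqx₀ : q * x₀ ≤ x₀ := by nlinarith
    have hrx₀ : r * x₀ ≤ x₀ := by nlinarith
    refine ⟨0, q, r, 1, IsGoodMix.of_bounds le_rfl hq hr (by linarith) zero_le_one le_rfl ?_
      fun v => ?_⟩
    · rw [abs_of_nonpos (by linarith : x₂ - x₀ ≤ 0), abs_of_nonpos (by linarith : x₁ - x₀ ≤ 0),
        abs_of_nonneg (by linarith : 0 ≤ x₀ - x₁), abs_of_nonneg h₀]
      linarith
    · rcases le_total v 0 with hv | hv
      · refine ⟨_, -3 * x₁, -x₂ - 2 * x₁, sub_le_iff_le_add'.1 le_rfl, ?_, ?_, ?_⟩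
        · have h3 := hDneg hv
          have h6 := hOneg hv
          unfold pairPot
          linarith
        · have h3 := hDneg hv
          have h6 := hOneg hv
          have h7 := le_abs_self (x₂ - v)
          rw [abs_of_nonneg (by linarith : 0 ≤ x₁ - v)]
          unfold pairPot
          linarith
        · rw [abs_of_nonneg h₁, abs_of_neg h₂]
          linarith
      · have h3 := hDpos hv
        have h6 := overshoot_nonneg x₁ x₂ 0 v
        refine ⟨_, x₁, x₂, sub_le_iff_le_add'.1 le_rfl, ?_, ?_, ?_⟩
        · have h7 := neg_abs_le (x₁ - v)
          rw [abs_of_nonpos (by linarith : x₂ - v ≤ 0)]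
          unfold pairPot
          linarith
        · unfold pairPot
          linarith
        · rw [abs_of_nonneg h₁, abs_of_neg h₂]
          linarith

lemma pairDist_add_le {a b c v : ℝ} (hc : 0 ≤ c) (hca : c ≤ a) (hcb : c ≤ b) :
    pairDist a b c v + c ≤ pairDist a b 0 v := by
  unfold pairDist
  grind

/-- With all taxis on one side no randomness is needed: the nearest one serves. -/
lemma exists_goodMix_of_nonneg {x₀ x₁ x₂ : ℝ} (h₀ : 0 ≤ x₀) (h₁ : 0 ≤ x₁) (h₂ : 0 ≤ x₂) :
    ∃ p₀ p₁ p₂ θ, IsGoodMix x₀ x₁ x₂ 0 p₀ p₁ p₂ θ := by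
  by_cases hx₀ : x₀ ≤ x₁ ∧ x₀ ≤ x₂
  · refine ⟨1, 0, 0, 0, IsGoodMix.of_bounds zero_le_one le_rfl le_rfl (by norm_num) le_rfl
      zero_le_one (by simp) fun v => ⟨-x₀, _, _, ?_, sub_le_iff_le_add'.1 le_rfl,
      sub_le_iff_le_add'.1 le_rfl, ?_⟩⟩
    · have h3 := pairDist_add_le (v := v) h₀ hx₀.1 hx₀.2
      have h4 : overshoot x₁ x₂ x₀ v ≤ overshoot x₁ x₂ 0 v := by
        rcases le_total x₁ x₂ with h | h
        · rw [overshoot_of_le h]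
          have := min_le_left x₀ (min v x₂)
          rw [max_eq_left (by linarith)]
          exact overshoot_nonneg _ _ _ _
        · rw [overshoot_of_ge h, overshoot_of_ge h]
          exact max_le_max le_rfl (sub_le_sub_left (max_le_max h₀ le_rfl) _)
      unfold pairPot
      linarith
    · rw [abs_of_nonneg h₀]
      linarith
  by_cases hx₁ : x₁ ≤ x₀ ∧ x₁ ≤ x₂
  · refine ⟨0, 1, 0, 0, IsGoodMix.of_bounds le_rfl zero_le_one le_rfl (by norm_num) le_rfl
      zero_le_one ?_ fun v => ⟨_, -x₁, _, sub_le_iff_le_add'.1 le_rfl, ?_,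
      sub_le_iff_le_add'.1 le_rfl, ?_⟩⟩
    · rw [abs_of_nonpos (by linarith), abs_of_nonneg h₀]
      linarith
    · have h3 := le_pairDist_of_nonneg h₁ hx₁.2 v
      have h4 := overshoot_nonneg x₁ x₂ 0 v
      unfold pairPot
      linarith
    · rw [abs_of_nonneg h₁]
      linarith
  have hx₂ : x₂ ≤ x₀ ∧ x₂ ≤ x₁ := by grind
  have h3 v := le_pairDist_of_nonneg h₂ hx₂.2 v
  simp only [pairDist_comm_left x₂] at h3
  rcases le_total x₁ x₀ with h | h
  · refine ⟨0, 0, 1, 1, IsGoodMix.of_bounds le_rfl le_rfl zero_le_one (by norm_num) zero_le_one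
      le_rfl ?_ fun v => ⟨_, _, -x₂, sub_le_iff_le_add'.1 le_rfl, sub_le_iff_le_add'.1 le_rfl,
      ?_, ?_⟩⟩
    · rw [abs_of_nonpos (by linarith : x₂ - x₀ ≤ 0), abs_of_nonneg h₀,
        abs_of_nonneg (by linarith : 0 ≤ x₀ - x₁)]
      linarith
    · have h4 := overshoot_nonneg x₁ x₂ 0 v
      unfold pairPot
      linarith [h3 v]
    · rw [abs_of_nonneg h₂]
      linarith
  · refine ⟨0, 0, 1, 0, IsGoodMix.of_bounds le_rfl le_rfl zero_le_one (by norm_num) le_rfl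
      zero_le_one ?_ fun v => ⟨_, _, -x₂, sub_le_iff_le_add'.1 le_rfl, sub_le_iff_le_add'.1 le_rfl,
      ?_, ?_⟩⟩
    · rw [abs_of_nonpos (by linarith : x₂ - x₀ ≤ 0), abs_of_nonneg h₀]
      linarith
    · have h4 : overshoot x₁ x₀ x₀ v ≤ overshoot x₁ x₂ 0 v := by
        rw [overshoot_of_ge h, overshoot_of_ge hx₂.2]
        exact max_le_max le_rfl (sub_le_sub_left (max_le_max h₀
          (max_le_max le_rfl hx₂.1)) _)
      unfold pairPot
      linarith [h3 v]
    · rw [abs_of_nonneg h₂]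
      linarith

/-- There are always good probabilities for serving a request. -/
theorem exists_goodMix (x₀ x₁ x₂ s : ℝ) : ∃ p₀ p₁ p₂ θ, IsGoodMix x₀ x₁ x₂ s p₀ p₁ p₂ θ := by
  suffices H : ∀ x₀ x₁ x₂ : ℝ, ∃ p₀ p₁ p₂ θ, IsGoodMix x₀ x₁ x₂ 0 p₀ p₁ p₂ θ by
    obtain ⟨p₀, p₁, p₂, θ, h⟩ := H (x₀ - s) (x₁ - s) (x₂ - s)
    exact ⟨p₀, p₁, p₂, θ, h.of_sub⟩
  intro x₀ x₁ x₂
  by_cases hne : x₀ = 0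
  · subst hne
    exact ⟨1, 0, 0, 0, IsGoodMix.of_bounds zero_le_one le_rfl le_rfl (by norm_num) le_rfl
      zero_le_one (by simp) fun v => ⟨0, _, _, by simp, sub_le_iff_le_add'.1 le_rfl,
      sub_le_iff_le_add'.1 le_rfl, by simp⟩⟩
  have hneg : (∃ p₀ p₁ p₂ θ, IsGoodMix (-x₀) (-x₁) (-x₂) 0 p₀ p₁ p₂ θ) →
      ∃ p₀ p₁ p₂ θ, IsGoodMix x₀ x₁ x₂ 0 p₀ p₁ p₂ θ := fun ⟨p₀, p₁, p₂, θ, h⟩ =>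
    ⟨p₀, p₁, p₂, θ, h.neg⟩
  rcases lt_or_ge x₀ 0 with h₀ | h₀ <;> rcases lt_or_ge x₁ 0 with h₁ | h₁ <;>
    rcases lt_or_ge x₂ 0 with h₂ | h₂
  · exact hneg (exists_goodMix_of_nonneg (by linarith) (by linarith) (by linarith))
  · rcases h₂.eq_or_lt with rfl | h₂
    · exact hneg (exists_goodMix_of_nonneg (by linarith) (by linarith) (by linarith))
    · exact hneg (exists_goodMix_of_neg_two (by linarith) (by linarith) (by linarith))
  · rcases h₁.eq_or_lt with rfl | h₁
    · exact hneg (exists_goodMix_of_nonneg (by linarith) (by linarith) (by linarith))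
    · exact hneg (exists_goodMix_of_neg_one (by linarith) (by linarith) (by linarith)
        (neg_ne_zero.2 hne))
  · exact exists_goodMix_of_neg_zero h₀ h₁ h₂
  · exact hneg (exists_goodMix_of_neg_zero (by
      have := lt_of_le_of_ne h₀ (Ne.symm hne)
      linarith) (by linarith) (by linarith))
  · exact exists_goodMix_of_neg_one h₀ h₁ h₂ hne
  · exact exists_goodMix_of_neg_two h₀ h₁ h₂
  · exact exists_goodMix_of_nonneg h₀ h₁ h₂

/-! ### The potential of three taxis and its drop under one request -/

/-- The potential of the three positions `z`, listed by role, and the configuration `y` for the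
matching `σ` between them. -/
noncomputable def matchPot (z : Fin 3 → ℝ) (y : Config 3 ℝ) (σ : Equiv.Perm (Fin 3)) : ℝ :=
  16 * |z 0 - y (σ 0)| + pairPot (z 1) (z 2) (y (σ 1)) (y (σ 2))

/-- The discrepancy between the three positions `z`, listed by role, and the configuration `y`. -/
noncomputable def pot (z : Fin 3 → ℝ) (y : Config 3 ℝ) : ℝ :=
  univ.inf' univ_nonempty (matchPot z y)

lemma pot_le_matchPot (z : Fin 3 → ℝ) (y : Config 3 ℝ) (σ : Equiv.Perm (Fin 3)) :
    pot z y ≤ matchPot z y σ := inf'_le _ (mem_univ σ)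

lemma exists_pot_eq (z : Fin 3 → ℝ) (y : Config 3 ℝ) : ∃ σ, pot z y = matchPot z y σ := by
  obtain ⟨σ, -, h⟩ := exists_mem_eq_inf' univ_nonempty (matchPot z y)
  exact ⟨σ, h⟩

lemma pot_nonneg (z : Fin 3 → ℝ) (y : Config 3 ℝ) : 0 ≤ pot z y := by
  obtain ⟨σ, h⟩ := exists_pot_eq z y
  have := pairPot_nonneg (z 1) (z 2) (y (σ 1)) (y (σ 2))
  rw [h, matchPot]
  positivity

lemma pot_self (z : Fin 3 → ℝ) : pot z z = 0 := by
  refine le_antisymm ((pot_le_matchPot z z 1).trans_eq ?_) (pot_nonneg z z)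
  simp [matchPot, pairPot_self]

/-- The minimum over matchings does not see the labels of the offline taxis. This lets a
role-ordered configuration stand in for an offline one. -/
lemma pot_comp_le (z : Fin 3 → ℝ) (y : Config 3 ℝ) (τ : Equiv.Perm (Fin 3)) :
    pot z (y ∘ τ) ≤ pot z y := by
  obtain ⟨σ, h⟩ := exists_pot_eq z y
  refine (pot_le_matchPot z _ (τ⁻¹ * σ)).trans_eq ?_
  simp [h, matchPot]

lemma pot_le_add_sum_dist (z : Fin 3 → ℝ) (y y' : Config 3 ℝ) :
    pot z y' ≤ pot z y + 16 * ∑ i, dist (y i) (y' i) := by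
  obtain ⟨σ, h⟩ := exists_pot_eq z y
  refine (pot_le_matchPot z y' σ).trans ?_
  have hs : ∑ i, dist (y i) (y' i) = ∑ i, |y (σ i) - y' (σ i)| :=
    (Equiv.sum_comp σ fun i => dist (y i) (y' i)).symm
  rw [hs, h, Fin.sum_univ_three, matchPot, matchPot]
  have h0 := abs_sub_le (z 0) (y (σ 0)) (y' (σ 0))
  have h1 := pairPot_le_right (z 1) (z 2) (y' (σ 1)) (y' (σ 2)) (y (σ 1))
  have h2 := pairPot_le_right (z 1) (z 2) (y' (σ 2)) (y (σ 1)) (y (σ 2))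
  rw [pairPot_comm_right _ _ (y' (σ 2)), pairPot_comm_right _ _ (y (σ 2))] at h2
  have := abs_nonneg (y (σ 1) - y' (σ 1))
  have := abs_nonneg (y (σ 2) - y' (σ 2))
  linarith

/-- The four ways to serve a request: role `0` of the new roles is given to the serving taxi. -/
def newRoles : Fin 4 → Equiv.Perm (Fin 3) :=
  ![1, Equiv.swap 0 1, Equiv.swap 0 2, (finRotate 3)⁻¹]

/-- The positions, listed by role, after serving a request with destination `t`. -/
def advance (z : Fin 3 → ℝ) (o : Fin 4) (t : ℝ) : Fin 3 → ℝ :=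
  Function.update (z ∘ newRoles o) 0 t

lemma pot_update_le {z : Fin 3 → ℝ} {y : Config 3 ℝ} {i : Fin 3} (t : ℝ)
    (τ : Equiv.Perm (Fin 3)) (hτ : τ 0 = i) :
    pot (Function.update z 0 t) (Function.update y i t) ≤
      pairPot (z 1) (z 2) (y (τ 1)) (y (τ 2)) := by
  refine (pot_le_matchPot _ _ τ).trans_eq ?_
  have h1 : τ 1 ≠ i := by
    rw [← hτ]
    exact τ.injective.ne (by decide)
  have h2 : τ 2 ≠ i := by
    rw [← hτ]
    exact τ.injective.ne (by decide)
  simp [matchPot, hτ, h1, h2]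

lemma newRoles_apply : newRoles 0 0 = 0 ∧ newRoles 0 1 = 1 ∧ newRoles 0 2 = 2 ∧
    newRoles 1 0 = 1 ∧ newRoles 1 1 = 0 ∧ newRoles 1 2 = 2 ∧
    newRoles 2 0 = 2 ∧ newRoles 2 1 = 1 ∧ newRoles 2 2 = 0 ∧
    newRoles 3 0 = 2 ∧ newRoles 3 1 = 0 ∧ newRoles 3 2 = 1 := by decide

lemma exists_weights (z : Fin 3 → ℝ) (s : ℝ) : ∃ w : Fin 4 → ℝ, (∀ o, 0 ≤ w o) ∧ ∑ o, w o = 1 ∧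
    ∀ (y : Config 3 ℝ) (i : Fin 3) (t : ℝ), y i = s →
      ∑ o, w o * (|z (newRoles o 0) - s| / 7 + pot (advance z o t) (Function.update y i t)) ≤
        pot z y := by
  obtain ⟨p₀, p₁, p₂, θ, h⟩ := exists_goodMix (z 0) (z 1) (z 2) s
  refine ⟨![p₀, p₁, p₂ * (1 - θ), p₂ * θ], ?_, ?_, fun y i t hy => ?_⟩
  · have := h.p₀_nonneg
    have := h.p₁_nonneg
    have := mul_nonneg h.p₂_nonneg (sub_nonneg.2 h.θ_le_one)
    have := mul_nonneg h.p₂_nonneg h.θ_nonneg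
    intro o
    fin_cases o <;> simpa
  · simp only [Fin.sum_univ_four, Matrix.cons_val]
    linarith [h.sum_eq_one]
  obtain ⟨r00, r01, r02, r10, r11, r12, r20, r21, r22, r30, r31, r32⟩ := newRoles_apply
  have key (τ : Equiv.Perm (Fin 3)) (hτ : τ 0 = i) (B : ℝ)
      (hB : p₀ * (pairPot (z 1) (z 2) (y (τ 1)) (y (τ 2)) + |z 0 - s| / 7) +
        p₁ * (pairPot (z 0) (z 2) (y (τ 1)) (y (τ 2)) + |z 1 - s| / 7) +
        p₂ * (mixPot θ (z 0) (z 1) (y (τ 1)) (y (τ 2)) + |z 2 - s| / 7) ≤ B) :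
      ∑ o, (![p₀, p₁, p₂ * (1 - θ), p₂ * θ] : Fin 4 → ℝ) o *
        (|z (newRoles o 0) - s| / 7 + pot (advance z o t) (Function.update y i t)) ≤ B := by
    refine le_trans ?_ hB
    have hpot o : pot (advance z o t) (Function.update y i t) ≤
        pairPot (z (newRoles o 1)) (z (newRoles o 2)) (y (τ 1)) (y (τ 2)) :=
      pot_update_le t τ hτ
    have a0 := mul_le_mul_of_nonneg_left (hpot 0) h.p₀_nonneg
    have a1 := mul_le_mul_of_nonneg_left (hpot 1) h.p₁_nonneg
    have a2 := mul_le_mul_of_nonneg_left (hpot 2)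
      (mul_nonneg h.p₂_nonneg (sub_nonneg.2 h.θ_le_one))
    have a3 := mul_le_mul_of_nonneg_left (hpot 3) (mul_nonneg h.p₂_nonneg h.θ_nonneg)
    simp only [Fin.sum_univ_four, Matrix.cons_val, r00, r01, r02, r10, r11, r12, r20, r21, r22,
      r30, r31, r32] at a0 a1 a2 a3 ⊢
    unfold mixPot
    linarith
  -- The offline server is not the partner of role `0`. That partner may be pretended to stand at `z
  -- 0`: the correction costs 3 per unit of distance, while `pot` provides 16.
  have key' (τ : Equiv.Perm (Fin 3)) (hτ : τ 0 = i) :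
      ∑ o, (![p₀, p₁, p₂ * (1 - θ), p₂ * θ] : Fin 4 → ℝ) o *
        (|z (newRoles o 0) - s| / 7 + pot (advance z o t) (Function.update y i t)) ≤
      16 * |z 0 - y (τ 1)| + pairPot (z 1) (z 2) s (y (τ 2)) := by
    refine key τ hτ _ ?_
    have b := h.pot_le' (y (τ 2))
    have b0 := mul_le_mul_of_nonneg_left
      (pairPot_le_right (z 1) (z 2) (y (τ 1)) (y (τ 2)) (z 0)) h.p₀_nonneg
    have b1 := mul_le_mul_of_nonneg_left
      (pairPot_le_right (z 0) (z 2) (y (τ 1)) (y (τ 2)) (z 0)) h.p₁_nonneg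
    have b2 := mul_le_mul_of_nonneg_left
      (pairPot_le_right (z 1) (z 0) (y (τ 1)) (y (τ 2)) (z 0))
      (mul_nonneg h.p₂_nonneg (sub_nonneg.2 h.θ_le_one))
    have b3 := mul_le_mul_of_nonneg_left
      (pairPot_le_right (z 0) (z 1) (y (τ 1)) (y (τ 2)) (z 0))
      (mul_nonneg h.p₂_nonneg h.θ_nonneg)
    have hd : |z 0 - y (τ 1)| = p₀ * |z 0 - y (τ 1)| + p₁ * |z 0 - y (τ 1)| +
        p₂ * |z 0 - y (τ 1)| := by rw [← add_mul, ← add_mul, h.sum_eq_one, one_mul]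
    have := abs_nonneg (z 0 - y (τ 1))
    unfold mixPot at b ⊢
    linarith
  obtain ⟨σ, hσ⟩ := exists_pot_eq z y
  rw [hσ, matchPot]
  obtain ⟨j, rfl⟩ := σ.surjective i
  fin_cases j
  · refine key σ rfl _ ?_
    have := h.pot_le (y (σ 1)) (y (σ 2))
    simp only [Fin.zero_eta, Fin.isValue] at hy
    rw [hy]
    linarith
  · simp only [Fin.mk_one, Fin.isValue] at hy
    have := key' (σ * Equiv.swap 0 1) (by simp)
    simpa [hy, Equiv.swap_apply_of_ne_of_ne] using this
  · simp only [Fin.reduceFinMk, Fin.isValue] at hy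
    -- This rotation makes the partner of role `2` the server; symmetry of `pairPot` in the offline
    -- pair reduces the case to the previous one.
    have := key' (σ * newRoles 3) (by simp [r30])
    rw [Equiv.Perm.mul_apply, Equiv.Perm.mul_apply, r31, r32, pairPot_comm_right] at this
    rw [hy]
    exact this

/-- Probabilities for serving a request at `s`, from the positions `z` listed by role. -/
noncomputable def weight (z : Fin 3 → ℝ) (s : ℝ) : Fin 4 → ℝ := (exists_weights z s).choose

lemma weight_nonneg (z : Fin 3 → ℝ) (s : ℝ) (o : Fin 4) : 0 ≤ weight z s o :=
  (exists_weights z s).choose_spec.1 o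

lemma sum_weight (z : Fin 3 → ℝ) (s : ℝ) : ∑ o, weight z s o = 1 :=
  (exists_weights z s).choose_spec.2.1

lemma sum_weight_mul_le (z : Fin 3 → ℝ) {s : ℝ} {y : Config 3 ℝ} {i : Fin 3} (t : ℝ)
    (hy : y i = s) :
    ∑ o, weight z s o * (|z (newRoles o 0) - s| / 7 +
      pot (advance z o t) (Function.update y i t)) ≤ pot z y :=
  (exists_weights z s).choose_spec.2.2 y i t hy

/-! ### Expected values and derandomization -/

/-- An expected value: a normalized monotone linear functional. -/
structure IsMean {α : Type*} (M : (α → ℝ) → ℝ) : Prop where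
  map_add : ∀ f g, M (fun a => f a + g a) = M f + M g
  map_mul : ∀ (c : ℝ) f, M (fun a => c * f a) = c * M f
  map_const : ∀ c : ℝ, M (fun _ => c) = c
  mono : ∀ f g, (∀ a, f a ≤ g a) → M f ≤ M g

lemma IsMean.map_sum {α ι : Type*} {M : (α → ℝ) → ℝ} (hM : IsMean M) (s : Finset ι)
    (f : ι → α → ℝ) : M (fun a => ∑ i ∈ s, f i a) = ∑ i ∈ s, M (f i) := by
  classical
  induction s using Finset.induction_on with
  | empty => simpa using hM.map_const 0
  | insert i s hi ih =>
    simp only [sum_insert hi]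
    rw [hM.map_add, ih]

/-- The distribution of the randomized algorithm after one more request. -/
noncomputable def stepMean (M : ((Fin 3 → ℝ) → ℝ) → ℝ) (r : Request ℝ)
    (f : (Fin 3 → ℝ) → ℝ) : ℝ :=
  M fun z => ∑ o, weight z r.start o * f (advance z o r.dest)

/-- The expected cost of the randomized algorithm for one more request. -/
noncomputable def stepCost (M : ((Fin 3 → ℝ) → ℝ) → ℝ) (r : Request ℝ) : ℝ :=
  M fun z => ∑ o, weight z r.start o * |z (newRoles o 0) - r.start|

lemma IsMean.stepMean {M : ((Fin 3 → ℝ) → ℝ) → ℝ} (hM : IsMean M) (r : Request ℝ) :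
    IsMean (stepMean M r) where
  map_add f g := by
    unfold KTaxi.stepMean
    simp only [mul_add, sum_add_distrib]
    exact hM.map_add _ _
  map_mul c f := by
    unfold KTaxi.stepMean
    rw [← hM.map_mul]
    simp only [mul_sum, mul_left_comm]
  map_const c := by
    unfold KTaxi.stepMean
    simp only [← sum_mul, sum_weight, one_mul]
    exact hM.map_const c
  mono f g h := hM.mono _ _ fun z => sum_le_sum fun o _ =>
    mul_le_mul_of_nonneg_left (h _) (weight_nonneg _ _ _)

/-- The randomized algorithm against an arbitrary schedule. -/
lemma IsMean.stepMean_pot_le {M : ((Fin 3 → ℝ) → ℝ) → ℝ} (hM : IsMean M) (r : Request ℝ)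
    (y : Config 3 ℝ) (m : Move 3 ℝ) (hm : m.Serves r) :
    stepCost M r / 7 + KTaxi.stepMean M r (fun z => pot z (m.result r)) ≤
      M (fun z => pot z y) + 16 * m.cost y := by
  have h z : ∑ o, weight z r.start o * |z (newRoles o 0) - r.start| * (1 / 7) +
      ∑ o, weight z r.start o * pot (advance z o r.dest) (m.result r) ≤
      pot z y + 16 * m.cost y := by
    refine le_trans ?_ (pot_le_add_sum_dist z y m.pos)
    refine le_trans (le_of_eq ?_) (sum_weight_mul_le z r.dest hm)
    rw [← sum_add_distrib]
    refine sum_congr rfl fun o _ => ?_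
    rw [Move.result]
    ring
  have h' := hM.mono _ _ h
  rw [hM.map_add, hM.map_add, hM.map_const] at h'
  refine le_trans (le_of_eq ?_) h'
  rw [stepCost, KTaxi.stepMean, div_eq_mul_one_div, mul_comm _ (1 / 7 : ℝ), ← hM.map_mul]
  simp only [sum_mul, mul_comm (1 / 7 : ℝ)]

/-- One of the four ways to serve a request is good against the randomized algorithm. -/
lemma IsMean.exists_option {M : ((Fin 3 → ℝ) → ℝ) → ℝ} (hM : IsMean M) (r : Request ℝ)
    (x : Fin 3 → ℝ) :
    ∃ o, |x (newRoles o 0) - r.start| / 7 + KTaxi.stepMean M r (pot (advance x o r.dest)) ≤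
      M (pot x) + 16 * stepCost M r := by
  by_contra! hcon
  -- Averaging over the algorithm's own weights at `x`: if every option failed, so would their mean.
  have h1 : M (pot x) + 16 * stepCost M r < ∑ o, weight x r.start o *
      (|x (newRoles o 0) - r.start| / 7 +
        KTaxi.stepMean M r (pot (advance x o r.dest))) := by
    calc _ = ∑ o, weight x r.start o * (M (pot x) + 16 * stepCost M r) := by
          rw [← sum_mul, sum_weight, one_mul]
      _ < _ := by
          obtain ⟨o, -, ho⟩ : ∃ o ∈ univ, 0 < weight x r.start o := by
            refine exists_lt_of_sum_lt ?_
            simp [sum_weight]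
          exact sum_lt_sum (fun o _ => mul_le_mul_of_nonneg_left (hcon o).le
            (weight_nonneg _ _ _)) ⟨o, mem_univ o, mul_lt_mul_of_pos_left (hcon o) ho⟩
  refine h1.not_ge ?_
  have hM' := hM.stepMean r
  have h2 : ∑ o, weight x r.start o * (|x (newRoles o 0) - r.start| / 7 +
      KTaxi.stepMean M r (pot (advance x o r.dest))) =
      KTaxi.stepMean M r (fun y => ∑ o, weight x r.start o *
        (|x (newRoles o 0) - r.start| / 7 + pot (advance x o r.dest) y)) := by
    rw [hM'.map_sum]
    refine sum_congr rfl fun o _ => ?_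
    rw [hM'.map_mul, hM'.map_add, hM'.map_const]
  rw [h2]
  unfold KTaxi.stepMean stepCost
  rw [← hM.map_mul, ← hM.map_add]
  refine hM.mono _ _ fun z => ?_
  have h3 q : ∑ o, weight x r.start o * (|x (newRoles o 0) - r.start| / 7 +
      pot (advance x o r.dest) (advance z q r.dest)) ≤
      pot x z + 16 * |z (newRoles q 0) - r.start| := by
    -- A sample `z` plays the offline side: its server drives to the start, at 16 times the distance
    -- in potential, and then rides for free.
    have h4 := sum_weight_mul_le x (s := r.start)
      (y := Function.update (z ∘ newRoles q) 0 r.start) (i := 0) r.dest (by simp)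
    rw [Function.update_idem] at h4
    refine h4.trans ?_
    have h5 := pot_le_add_sum_dist x (z ∘ newRoles q)
      (Function.update (z ∘ newRoles q) 0 r.start)
    have h6 : ∑ i, dist ((z ∘ newRoles q) i) (Function.update (z ∘ newRoles q) 0 r.start i) =
        |z (newRoles q 0) - r.start| := by
      simp [Fin.sum_univ_three, Real.dist_eq]
    rw [h6] at h5
    linarith [pot_comp_le x z (newRoles q)]
  calc _ ≤ ∑ q, weight z r.start q * (pot x z + 16 * |z (newRoles q 0) - r.start|) :=
        sum_le_sum fun q _ => mul_le_mul_of_nonneg_left (h3 q) (weight_nonneg _ _ _)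
    _ = _ := by
        simp only [mul_add, sum_add_distrib, ← sum_mul, sum_weight, one_mul, mul_sum]
        congr 1
        exact sum_congr rfl fun q _ => by ring

/-! ### The deterministic algorithm and its competitive ratio -/

/-- The state of the deterministic algorithm: the distribution of the simulated randomized
algorithm, the positions of the taxis and the taxis in the three roles. -/
structure State where
  mean : ((Fin 3 → ℝ) → ℝ) → ℝ
  isMean : IsMean mean
  pos : Config 3 ℝ
  role : Equiv.Perm (Fin 3)

namespace State

/-- The positions of the taxis listed by role. -/
def byRole (S : State) : Fin 3 → ℝ := S.pos ∘ S.role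

/-- The way in which the deterministic algorithm serves the next request. -/
noncomputable def option (S : State) (r : Request ℝ) : Fin 4 :=
  (S.isMean.exists_option r S.byRole).choose

lemma option_spec (S : State) (r : Request ℝ) :
    |S.byRole (newRoles (S.option r) 0) - r.start| / 7 +
      stepMean S.mean r (pot (advance S.byRole (S.option r) r.dest)) ≤
      S.mean (pot S.byRole) + 16 * stepCost S.mean r :=
  (S.isMean.exists_option r S.byRole).choose_spec

/-- The taxi that serves the next request. -/
noncomputable def server (S : State) (r : Request ℝ) : Fin 3 := S.role (newRoles (S.option r) 0)

/-- The move of the deterministic algorithm for the next request. -/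
noncomputable def move (S : State) (r : Request ℝ) : Move 3 ℝ where
  pos := Function.update S.pos (S.server r) r.start
  taxi := S.server r

/-- The state of the deterministic algorithm after the next request. -/
noncomputable def next (S : State) (r : Request ℝ) : State where
  mean := stepMean S.mean r
  isMean := S.isMean.stepMean r
  pos := (S.move r).result r
  role := S.role * newRoles (S.option r)

/-- The initial state. -/
def init (C : Config 3 ℝ) : State where
  mean f := f C
  isMean := ⟨fun _ _ => rfl, fun _ _ => rfl, fun _ => rfl, fun _ _ h => h C⟩
  pos := C
  role := 1

lemma byRole_next (S : State) (r : Request ℝ) :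
    (S.next r).byRole = advance S.byRole (S.option r) r.dest := by
  have h : S.server r = (S.role * newRoles (S.option r)) 0 := rfl
  simp only [byRole, next, move, Move.result, Function.update_idem, advance, h]
  rw [Function.update_comp_eq_of_injective _ (Equiv.injective _)]
  rfl

lemma cost_move (S : State) (r : Request ℝ) :
    (S.move r).cost S.pos = |S.byRole (newRoles (S.option r) 0) - r.start| := by
  have h (i : Fin 3) : ∑ j, dist (S.pos j) (Function.update S.pos i r.start j) =
      |S.pos i - r.start| := by
    rw [sum_eq_single i (fun j _ hj => by simp [hj]) (by simp)]
    simp [Real.dist_eq]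
  exact h _

/-- The potential of the deterministic algorithm against a configuration `y`. -/
noncomputable def potential (S : State) (y : Config 3 ℝ) : ℝ :=
  -- The 7 turns a seventh of the deterministic cost into the whole. The resulting charge of 7 · 16
  -- times the randomized cost is paid by the second term, whence 784 = 7 · 16 · 7.
  7 * S.mean (pot S.byRole) + 784 * S.mean (fun z => pot z y)

lemma potential_nonneg (S : State) (y : Config 3 ℝ) : 0 ≤ S.potential y := by
  have h1 := S.isMean.mono _ _ fun z => pot_nonneg S.byRole z
  have h2 := S.isMean.mono _ _ fun z => pot_nonneg z y
  rw [S.isMean.map_const] at h1 h2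
  unfold potential
  positivity

lemma cost_add_potential_le (S : State) (r : Request ℝ) (y : Config 3 ℝ) (m : Move 3 ℝ)
    (hm : m.Serves r) :
    (S.move r).cost S.pos + (S.next r).potential (m.result r) ≤
      S.potential y + 12544 * m.cost y := by
  have h1 := S.option_spec r
  have h2 := S.isMean.stepMean_pot_le r y m hm
  rw [← cost_move, ← byRole_next] at h1
  have h3 : (S.next r).mean = stepMean S.mean r := rfl
  unfold potential
  rw [h3]
  linarith

end State

/-- The deterministic online algorithm. -/
noncomputable def threeTaxi : OnlineAlgorithm 3 ℝ where
  move C past r := (past.foldl State.next (State.init C)).move r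
  serves C past r := by simp [Move.Serves, State.move]

/-- The stepwise inequality telescopes, and the final potential is dropped because it is
nonnegative. Both `past` and `y` must vary in the induction. -/
lemma threeTaxi_cost_runFrom_le (C : Config 3 ℝ) (σ : List (Request ℝ)) :
    ∀ (past : List (Request ℝ)) (y : Config 3 ℝ) (ms : List (Move 3 ℝ)), IsSchedule σ ms →
      scheduleCost (past.foldl State.next (State.init C)).pos σ
        (threeTaxi.runFrom C past σ) ≤
      (past.foldl State.next (State.init C)).potential y + 12544 * scheduleCost y σ ms := by
  induction σ with
  | nil =>
    intro past y ms _
    simpa [scheduleCost] using State.potential_nonneg _ y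
  | cons r σ ih =>
    intro past y ms h
    obtain ⟨m, ms, hm, hms, rfl⟩ := List.forall₂_cons_left_iff.1 h
    set S := past.foldl State.next (State.init C) with hS
    have hnext : (past ++ [r]).foldl State.next (State.init C) = S.next r := by
      rw [List.foldl_append, ← hS]
      rfl
    have h1 := ih (past ++ [r]) (m.result r) ms hms
    rw [hnext] at h1
    have h2 := S.cost_add_potential_le r y m hm
    have h3 : scheduleCost S.pos (r :: σ) (threeTaxi.runFrom C past (r :: σ)) =
        (S.move r).cost S.pos +
          scheduleCost (S.next r).pos σ (threeTaxi.runFrom C (past ++ [r]) σ) := rfl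
    have h4 : scheduleCost y (r :: σ) (m :: ms) =
        m.cost y + scheduleCost (m.result r) σ ms := rfl
    rw [h3, h4]
    linarith

lemma OnlineAlgorithm.isSchedule_runFrom {k : ℕ} {M : Type*} (A : OnlineAlgorithm k M)
    (C : Config k M) (σ : List (Request M)) :
    ∀ past : List (Request M), IsSchedule σ (A.runFrom C past σ) := by
  induction σ with
  | nil => exact fun _ => List.Forall₂.nil
  | cons r σ ih => exact fun past => List.Forall₂.cons (A.serves C past r) (ih _)

lemma threeTaxi_isCompetitive : threeTaxi.IsCompetitive 12544 := by
  refine ⟨0, fun C σ => ?_⟩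
  have h : threeTaxi.cost C σ / 12544 ≤ opt C σ := by
    refine le_csInf ⟨_, _, threeTaxi.isSchedule_runFrom C σ [], rfl⟩ ?_
    rintro _ ⟨ms, hms, rfl⟩
    have h1 : threeTaxi.cost C σ ≤ _ := threeTaxi_cost_runFrom_le C σ [] C ms hms
    -- All sides start at `C`, so the additive constant is zero.
    have h2 : (State.init C).potential C = 0 := by
      simp [State.potential, State.init, State.byRole, pot_self]
    rw [List.foldl_nil, h2] at h1
    linarith
  linarith

end KTaxi

/-- There is an O(1)-competitive deterministic online algorithm for the hard 3-taxi problem on the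
real line. -/
theorem theorem5 : ∃ (A : KTaxi.OnlineAlgorithm 3 ℝ) (ρ : ℝ), A.IsCompetitive ρ := by
  exact ⟨KTaxi.threeTaxi, 12544, KTaxi.threeTaxi_isCompetitive⟩
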